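/- Let $X$ be a real Banach space and let $cb(X)$ be the family of all nonempty bounded closed convex subsets of $X$, with the Hausdorff metric $d_H$. A partition of $[0,1]$ is a finite family $\{(I_1,t_1),\dots,(I_p,t_p)\}$, where $I_1,\dots,I_p$ are nondegenerate non-overlapping closed intervals with union $[0,1]$ and $t_i\in[0,1]$; it is a Perron partition if $t_i\in I_i$ for all $i$. For a gauge $\delta:[0,1]\to(0,\infty)$ it is $\delta$-fine if $I_i\subset[t_i-\delta(t_i),t_i+\delta(t_i)]$ for all $i$. A set $A\in cb(X)$ is the Henstock (resp. McShane) integral of $\Gamma:[0,1]\to cb(X)$ if for every $\varepsilon>0$ there is a gauge $\delta$ such that $$d_H\Bigl(A,\sum_{i=1}^p\Gamma(t_i)\lambda(I_i)\Bigr)<\varepsilon$$ for every $\delta$-fine Perron partition (resp. every $\delta$-fine partition) of $[0,1]$, where $\lambda$ is Lebesgue measure. For a closed interval $I\subset[0,1]$, $\Phi_\Gamma(I)$ denotes the integral of the multifunction equal to $\Gamma$ on $I$ and to $\{0\}$ off $I$. $\Gamma$ is variationally Henstock (resp. McShane) integrable if the Henstock (resp. McShane) integrals $\Phi_\Gamma(I)\in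 cb(X)$ exist for all $I$, and for every $\varepsilon>0$ there is a gauge $\delta$ such that $$\sum_{i=1}^p d_H\bigl(\Phi_\Gamma(I_i),\Gamma(t_i)\lambda(I_i)\bigr)<\varepsilon$$ for every $\delta$-fine Perron partition (resp. every $\delta$-fine partition) of $[0,1]$. The interval variation of $\Phi_\Gamma$ is $$\widetilde{\Phi}_\Gamma([0,1])=\sup\Bigl\{\sum_i d_H(\Phi_\Gamma(I_i),\{0\}) : \{I_1,\dots,I_n\}\text{ is a finite partition of }[0,1]\text{ into closed intervals}\Bigr\}.$$ Theorem. A multifunction $\Gamma:[0,1]\to cb(X)$ is variationally McShane integrable if and only if it is variationally Henstock integrable and the interval variation of its Henstock integral $\Phi_\Gamma$ is finite. -/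

import Mathlib

open scoped Pointwise

namespace MultiInt

/-- `cb(X)`: the nonempty closed convex bounded subsets of `X`. -/
@[ext]
structure CB (X : Type*) [NormedAddCommGroup X] [NormedSpace ℝ X] where
  carrier : Set X
  nonempty : carrier.Nonempty
  isClosed : IsClosed carrier
  convex : Convex ℝ carrier
  isBounded : Bornology.IsBounded carrier

instance {X : Type*} [NormedAddCommGroup X] [NormedSpace ℝ X] : CoeOut (CB X) (Set X) :=
  ⟨CB.carrier⟩

/-- The element `{0}` of `cb(X)`. -/
instance {X : Type*} [NormedAddCommGroup X] [NormedSpace ℝ X] : Zero (CB X) :=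
  ⟨{ carrier := {0}
     nonempty := Set.singleton_nonempty 0
     isClosed := isClosed_singleton
     convex := convex_singleton 0
     isBounded := Bornology.isBounded_singleton }⟩

/-- The nonempty closed subintervals `[a, b]` of `[0,1]`. -/
abbrev Interval : Type := NonemptyInterval unitInterval

/-- The Lebesgue measure of an interval. -/
def Interval.length (I : Interval) : ℝ := (I.snd : ℝ) - (I.fst : ℝ)

/-- A finite partition of `[0,1]` into nondegenerate nonoverlapping closed intervals. -/
structure IntervalPartition where
  n : ℕ
  I : Fin n → Interval
  nondegenerate : ∀ i, (I i).fst < (I i).snd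
  nonoverlapping : Pairwise fun i j =>
    Disjoint (Set.Ioo (I i).fst (I i).snd) (Set.Ioo (I j).fst (I j).snd)
  cover : ⋃ i, (I i : Set unitInterval) = Set.univ

/-- A (McShane) partition `{(I₁,t₁), …, (Iₙ,tₙ)}`: the tags are arbitrary points of `[0,1]`. -/
structure TaggedPartition extends IntervalPartition where
  tag : Fin n → unitInterval

/-- A Perron partition: each tag lies in its interval. -/
def TaggedPartition.IsPerron (π : TaggedPartition) : Prop :=
  ∀ i, π.tag i ∈ π.I i

/-- `δ`-fineness: `Iᵢ ⊆ [tᵢ - δ(tᵢ), tᵢ + δ(tᵢ)]`. -/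
def TaggedPartition.IsFine (π : TaggedPartition) (δ : unitInterval → ℝ) : Prop :=
  ∀ i, ∀ s ∈ π.I i,
    (s : ℝ) ∈ Set.Icc ((π.tag i : ℝ) - δ (π.tag i)) ((π.tag i : ℝ) + δ (π.tag i))

/-- A gauge: a positive function on `[0,1]`. -/
def IsGauge (δ : unitInterval → ℝ) : Prop := ∀ t, 0 < δ t

section Integrals

variable {X : Type*} [NormedAddCommGroup X] [NormedSpace ℝ X]

/-- The multifunction `Γ χ_I`, equal to `Γ` on `I` and to `{0}` off `I`. -/
noncomputable def restrict (Γ : unitInterval → CB X) (I : Interval) : unitInterval → CB X :=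
  open Classical in fun t => if t ∈ I then Γ t else 0

/-- The Riemann sum `∑ Γ(tᵢ) λ(Iᵢ)` (Minkowski sum of sets). The Hausdorff distance does not
distinguish it from its closure, which is the sum in `cb(X)`. -/
def riemannSum (Γ : unitInterval → CB X) (π : TaggedPartition) : Set X :=
  ∑ i, (π.I i).length • (Γ (π.tag i) : Set X)

/-- `A` is the Henstock integral of `Γ` on `[0,1]`. -/
def HasHenstockIntegral (Γ : unitInterval → CB X) (A : CB X) : Prop :=
  ∀ ε : ℝ, 0 < ε → ∃ δ, IsGauge δ ∧ ∀ π : TaggedPartition, π.IsPerron → π.IsFine δ →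
    Metric.hausdorffDist (A : Set X) (riemannSum Γ π) < ε

/-- `A` is the McShane integral of `Γ` on `[0,1]`. -/
def HasMcShaneIntegral (Γ : unitInterval → CB X) (A : CB X) : Prop :=
  ∀ ε : ℝ, 0 < ε → ∃ δ, IsGauge δ ∧ ∀ π : TaggedPartition, π.IsFine δ →
    Metric.hausdorffDist (A : Set X) (riemannSum Γ π) < ε

/-- `Φ` is the indefinite Henstock integral of `Γ`: `Φ(I)` is the integral of `Γ χ_I`. -/
def IsIndefiniteHenstockIntegral (Γ : unitInterval → CB X) (Φ : Interval → CB X) : Prop :=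
  ∀ I, HasHenstockIntegral (restrict Γ I) (Φ I)

/-- `Φ` is the indefinite McShane integral of `Γ`: `Φ(I)` is the integral of `Γ χ_I`. -/
def IsIndefiniteMcShaneIntegral (Γ : unitInterval → CB X) (Φ : Interval → CB X) : Prop :=
  ∀ I, HasMcShaneIntegral (restrict Γ I) (Φ I)

/-- `∑ d_H(Φ(Iᵢ), Γ(tᵢ) λ(Iᵢ))`. -/
noncomputable def variationalSum (Γ : unitInterval → CB X) (Φ : Interval → CB X)
    (π : TaggedPartition) : ℝ :=
  ∑ i, Metric.hausdorffDist (Φ (π.I i) : Set X) ((π.I i).length • (Γ (π.tag i) : Set X))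

/-- Variational Henstock integrability on `[0,1]`. -/
def VariationallyHenstockIntegrable (Γ : unitInterval → CB X) : Prop :=
  ∃ Φ, IsIndefiniteHenstockIntegral Γ Φ ∧
    ∀ ε : ℝ, 0 < ε → ∃ δ, IsGauge δ ∧ ∀ π : TaggedPartition, π.IsPerron → π.IsFine δ →
      variationalSum Γ Φ π < ε

/-- Variational McShane integrability on `[0,1]`. -/
def VariationallyMcShaneIntegrable (Γ : unitInterval → CB X) : Prop :=
  ∃ Φ, IsIndefiniteMcShaneIntegral Γ Φ ∧
    ∀ ε : ℝ, 0 < ε → ∃ δ, IsGauge δ ∧ ∀ π : TaggedPartition, π.IsFine δ →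
      variationalSum Γ Φ π < ε

/-- The interval variation of `Φ` on `[0,1]`: the supremum of `∑ d_H(Φ(Iᵢ), {0})` over all finite
interval partitions of `[0,1]`. -/
noncomputable def intervalVariation (Φ : Interval → CB X) : ENNReal :=
  ⨆ P : IntervalPartition, ∑ i, Metric.hausdorffEDist (Φ (P.I i) : Set X) {0}

end Integrals

end MultiInt

/-! Support functions on the dual unit ball embed the nonempty bounded convex sets into a Banach
space of bounded functions. Minkowski sums and nonnegative multiples become linear operations, and
by Hahn-Banach separation the Hausdorff distance becomes the norm of the difference
(`hausdorffDist_eq_norm_supportFun_sub`). The problem is thus about a vector function `f` and its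
interval function `φ`, and Bochner integrability of `f` links both sides.

A Bochner integrable `f` is variationally McShane integrable (`exists_gauge_sum_norm_lt`), and the
variation of its primitive is at most `∫ ‖f‖`. Conversely, a variational Henstock primitive has
dyadic difference quotients converging to `f` almost everywhere (`ae_tendsto_cell`). This makes `f`
strongly measurable, and Fatou's lemma bounds `∫ ‖f‖` by the dyadic sums of `‖φ‖`
(`integrable_of_sum_cells_le`). Those sums are bounded by the interval variation in one direction;
in the other, by compactness and the freedom of McShane tags (`exists_sum_cells_le`). Uniqueness of
Henstock integrals identifies `φ` with the Bochner primitive. -/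

open MeasureTheory Filter Topology

namespace MultiInt

/-! ### Tagged divisions and Cousin's lemma -/

/-- `[a, b]` has a finite tagged partition into nondegenerate nonoverlapping intervals, all of whose
members satisfy `p`, with `∑ w (Iᵢ, tᵢ) ≥ s`. -/
def HasDivision (p : Interval → unitInterval → Prop) (w : Interval → unitInterval → ℝ)
    (a b : unitInterval) (s : ℝ) : Prop :=
  ∃ (n : ℕ) (I : Fin n → Interval) (tag : Fin n → unitInterval),
    (∀ i, (I i).fst < (I i).snd) ∧
    (Pairwise fun i j =>
      Disjoint (Set.Ioo (I i).fst (I i).snd) (Set.Ioo (I j).fst (I j).snd)) ∧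
    (⋃ i, (I i : Set unitInterval)) = Set.Icc a b ∧
    (∀ i, p (I i) (tag i)) ∧ s ≤ ∑ i, w (I i) (tag i)

section Division

variable {p : Interval → unitInterval → Prop} {w : Interval → unitInterval → ℝ}
  {a b c : unitInterval} {s s' : ℝ}

theorem HasDivision.single {I : Interval} {t : unitInterval} (hI : I.fst < I.snd)
    (h : p I t) (hs : s ≤ w I t) : HasDivision p w I.fst I.snd s :=
  ⟨1, fun _ => I, fun _ => t, fun _ => hI,
    fun i j hij => absurd (Subsingleton.elim i j) hij, by simp only [NonemptyInterval.coe_def, Set.iUnion_const],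
    fun _ => h, by simpa using hs⟩

theorem HasDivision.append (hab : a ≤ b) (hbc : b ≤ c)
    (h₁ : HasDivision p w a b s) (h₂ : HasDivision p w b c s') :
    HasDivision p w a c (s + s') := by
  obtain ⟨n, I, t, hd, hn, hu, hp, hs⟩ := h₁
  obtain ⟨m, J, u, hd', hn', hu', hp', hs'⟩ := h₂
  have hI (i) : (I i).snd ≤ b := by
    have : (I i).snd ∈ Set.Icc a b := by
      rw [← hu]; exact Set.mem_iUnion.2 ⟨i, (I i).fst_le_snd, le_rfl⟩
    exact this.2
  have hJ (i) : b ≤ (J i).fst := by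
    have : (J i).fst ∈ Set.Icc b c := by
      rw [← hu']; exact Set.mem_iUnion.2 ⟨i, le_rfl, (J i).fst_le_snd⟩
    exact this.1
  have hIJ (i j) : Disjoint (Set.Ioo (I i).fst (I i).snd) (Set.Ioo (J j).fst (J j).snd) :=
    Set.disjoint_left.2 fun x hx hy =>
      absurd ((hx.2.trans_le (hI i)).trans_le (hJ j)) hy.1.not_gt
  refine ⟨n + m, Fin.append I J, Fin.append t u, ?_, ?_, ?_, ?_, ?_⟩
  · intro i
    induction i using Fin.addCases <;> simp [hd, hd']
  · intro i j hij
    induction i using Fin.addCases <;> induction j using Fin.addCases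
    · simpa using hn fun h => hij (by rw [h])
    · simpa using hIJ _ _
    · simpa using (hIJ _ _).symm
    · simpa using hn' fun h => hij (by rw [h])
  · rw [← Set.Icc_union_Icc_eq_Icc hab hbc, ← hu, ← hu']
    ext x
    simp only [Set.mem_iUnion, Set.mem_union]
    constructor
    · rintro ⟨i, hi⟩
      induction i using Fin.addCases with
      | left i => exact Or.inl ⟨i, by simpa using hi⟩
      | right i => exact Or.inr ⟨i, by simpa using hi⟩
    · rintro (⟨i, hi⟩ | ⟨i, hi⟩)
      · exact ⟨Fin.castAdd m i, by simpa using hi⟩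
      · exact ⟨Fin.natAdd n i, by simpa using hi⟩
  · intro i
    induction i using Fin.addCases <;> simp [hp, hp']
  · simpa [Fin.sum_univ_add] using add_le_add hs hs'

theorem HasDivision.mono (h : HasDivision p w a b s) (hs : s' ≤ s) : HasDivision p w a b s' := by
  obtain ⟨n, I, t, hd, hn, hu, hp, h⟩ := h
  exact ⟨n, I, t, hd, hn, hu, hp, hs.trans h⟩

theorem HasDivision.exists_taggedPartition (h : HasDivision p w 0 1 s) :
    ∃ π : TaggedPartition, (∀ i, p (π.I i) (π.tag i)) ∧ s ≤ ∑ i, w (π.I i) (π.tag i) := by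
  obtain ⟨n, I, t, hd, hn, hu, hp, h⟩ := h
  refine ⟨⟨⟨n, I, hd, hn, ?_⟩, t⟩, hp, h⟩
  rw [hu]
  exact Set.eq_univ_of_forall fun x => ⟨unitInterval.nonneg', unitInterval.le_one'⟩

end Division

/-- The pair `(I, t)` may occur in a `δ`-fine Perron partition. -/
def FinePerron (δ : unitInterval → ℝ) (I : Interval) (t : unitInterval) : Prop :=
  t ∈ I ∧ ∀ s ∈ I, (s : ℝ) ∈ Set.Icc ((t : ℝ) - δ t) ((t : ℝ) + δ t)

/-- Cousin's lemma. -/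
theorem hasDivision_finePerron {δ : unitInterval → ℝ} (hδ : IsGauge δ) {a b : unitInterval}
    (hab : a < b) {w : Interval → unitInterval → ℝ} (hw : ∀ I t, 0 ≤ w I t) :
    HasDivision (FinePerron δ) w a b 0 := by
  -- The premise `a < z` admits `a` itself: the degenerate interval `[a, a]` has no division.
  let R : Set unitInterval := {z | a < z → HasDivision (FinePerron δ) w a z 0}
  have step {x t y : unitInterval} (hx : x ∈ R) (hax : a ≤ x) (hxt : x ≤ t) (hty : t ≤ y)
      (h₁ : (t : ℝ) - δ t ≤ x) (h₂ : (y : ℝ) ≤ t + δ t) : y ∈ R := by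
    intro hay
    rcases (hxt.trans hty).eq_or_lt with rfl | hxy
    · exact hx hay
    have h : HasDivision (FinePerron δ) w x y 0 :=
      HasDivision.single (I := ⟨(x, y), hxy.le⟩) (t := t) hxy
        ⟨⟨hxt, hty⟩, fun s hs => ⟨h₁.trans hs.1, le_trans (Subtype.coe_le_coe.2 hs.2) h₂⟩⟩ (hw _ _)
    rcases hax.eq_or_lt with rfl | hax'
    · exact h
    · simpa using (hx hax').append hax hxy.le h
  -- Whole initial segments are required so that a limit point approached from the right is also
  -- covered.
  let S : Set unitInterval := {x | ∀ z ∈ Set.Icc a x, z ∈ R}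
  have near (x : unitInterval) : ∀ᶠ y : unitInterval in 𝓝 x, (x : ℝ) - δ x < y ∧ (y : ℝ) < x + δ x := by
    have h₁ : ∀ᶠ r in 𝓝 (x : ℝ), (x : ℝ) - δ x < r ∧ r < x + δ x :=
      Ioo_mem_nhds (by linarith [hδ x]) (by linarith [hδ x])
    exact continuous_subtype_val.continuousAt.eventually h₁
  have hS : Set.Icc a b ⊆ S := by
    refine IsClosed.Icc_subset_of_forall_exists_gt ?_ ?_ ?_
    · refine isClosed_of_closure_subset fun x hx => ?_
      have hxI : x ∈ Set.Icc a b :=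
        closure_minimal Set.inter_subset_right isClosed_Icc hx
      refine ⟨fun z hz => ?_, hxI⟩
      rcases hz.2.eq_or_lt with rfl | hzx
      · obtain ⟨y, hy, hyS⟩ := mem_closure_iff_nhds.1 hx _ (near z)
        rcases le_total z y with h | h
        · exact hyS.1 z ⟨hz.1, h⟩
        · exact step (hyS.1 y ⟨hyS.2.1, le_rfl⟩) hyS.2.1 h le_rfl hy.1.le (by linarith [hδ z])
      · obtain ⟨y, hy, hyS⟩ := mem_closure_iff_nhds.1 hx _ (Ioi_mem_nhds hzx)
        exact hyS.1 z ⟨hz.1, le_of_lt hy⟩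
    · intro z hz haz
      exact absurd haz hz.2.not_gt
    · rintro x ⟨hxS, hx⟩ y hy
      have h : ∀ᶠ y : unitInterval in 𝓝[>] x, (x : ℝ) - δ x < y ∧ (y : ℝ) < x + δ x :=
        nhdsWithin_le_nhds (near x)
      have : (𝓝[>] x).NeBot := nhdsGT_neBot_of_exists_gt ⟨y, hy⟩
      obtain ⟨v, hv, hxv⟩ := (h.and (Ioc_mem_nhdsGT hy)).exists
      refine ⟨v, fun z hz => ?_, hxv⟩
      rcases le_total z x with h | h
      · exact hxS z ⟨hz.1, h⟩
      · have : (z : ℝ) ≤ v := hz.2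
        exact step (hxS x ⟨hx.1, le_rfl⟩) hx.1 le_rfl h (by linarith [hδ x]) (by linarith [hv.2])
  exact hS ⟨hab.le, le_rfl⟩ b ⟨hab.le, le_rfl⟩ hab

theorem exists_isPerron_isFine {δ : unitInterval → ℝ} (hδ : IsGauge δ) :
    ∃ π : TaggedPartition, π.IsPerron ∧ π.IsFine δ := by
  obtain ⟨π, hπ, -⟩ := (hasDivision_finePerron hδ (zero_lt_one (α := unitInterval))
    (w := fun _ _ => 0) fun _ _ => le_rfl).exists_taggedPartition
  exact ⟨π, fun i => (hπ i).1, fun i => (hπ i).2⟩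

/-! ### Support functions and the Rådström–Hörmander embedding -/

section Support

variable {X : Type*} [NormedAddCommGroup X] [NormedSpace ℝ X]

/-- A nonempty bounded convex set. -/
structure IsConvexBody (A : Set X) : Prop where
  nonempty : A.Nonempty
  convex : Convex ℝ A
  isBounded : Bornology.IsBounded A

theorem CB.isConvexBody (A : CB X) : IsConvexBody (A : Set X) :=
  ⟨A.nonempty, A.convex, A.isBounded⟩

theorem isConvexBody_zero : IsConvexBody (0 : Set X) :=
  (0 : CB X).isConvexBody

/-- Stability under Minkowski sums is why closedness is not part of `IsConvexBody`: a sum of closed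
sets need not be closed, and support functions do not see the closure. -/
theorem IsConvexBody.add {A B : Set X} (hA : IsConvexBody A) (hB : IsConvexBody B) :
    IsConvexBody (A + B) :=
  ⟨hA.nonempty.add hB.nonempty, hA.convex.add hB.convex, hA.isBounded.add hB.isBounded⟩

theorem IsConvexBody.smul {A : Set X} (hA : IsConvexBody A) (r : ℝ) : IsConvexBody (r • A) :=
  ⟨hA.nonempty.smul_set, hA.convex.smul r, hA.isBounded.smul₀ r⟩

variable (X) in
/-- The space of bounded functions on the unit ball of the dual of `X`. -/
abbrev SupportSpace : Type _ :=
  lp (fun _ : {f : X →L[ℝ] ℝ // ‖f‖ ≤ 1} => ℝ) ⊤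

theorem IsConvexBody.bddAbove_image {A : Set X} (hA : IsConvexBody A) (f : X →L[ℝ] ℝ) :
    BddAbove (f '' A) :=
  (f.lipschitz.isBounded_image hA.isBounded).bddAbove

theorem IsConvexBody.memℓp {A : Set X} (hA : IsConvexBody A) :
    Memℓp (fun f : {f : X →L[ℝ] ℝ // ‖f‖ ≤ 1} => sSup (f.1 '' A)) ⊤ := by
  obtain ⟨R, hR⟩ := hA.isBounded.exists_norm_le
  obtain ⟨a, ha⟩ := hA.nonempty
  refine memℓp_infty ⟨R, ?_⟩
  rintro _ ⟨f, rfl⟩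
  have hf (x) (hx : x ∈ A) : |f.1 x| ≤ R :=
    (f.1.le_of_opNorm_le f.2 x).trans (by simpa using hR x hx)
  refine abs_le.2 ⟨?_, ?_⟩
  · exact (abs_le.1 (hf a ha)).1.trans
      (le_csSup (hA.bddAbove_image _) (Set.mem_image_of_mem _ ha))
  · refine csSup_le (hA.nonempty.image _) ?_
    rintro _ ⟨x, hx, rfl⟩
    exact (abs_le.1 (hf x hx)).2

open Classical in
/-- The support function of a convex body, restricted to the unit ball of the dual. -/
noncomputable def supportFun (A : Set X) : SupportSpace X :=
  if h : IsConvexBody A then ⟨fun f => sSup (f.1 '' A), h.memℓp⟩ else 0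

theorem IsConvexBody.supportFun_apply {A : Set X} (hA : IsConvexBody A)
    (f : {f : X →L[ℝ] ℝ // ‖f‖ ≤ 1}) : supportFun A f = sSup (f.1 '' A) := by
  simp [supportFun, hA]

theorem supportFun_zero : supportFun (0 : Set X) = 0 := by
  ext f
  rw [isConvexBody_zero.supportFun_apply]
  simp [← Set.singleton_zero]

theorem supportFun_add {A B : Set X} (hA : IsConvexBody A) (hB : IsConvexBody B) :
    supportFun (A + B) = supportFun A + supportFun B := by
  ext f
  rw [lp.coeFn_add, Pi.add_apply, (hA.add hB).supportFun_apply, hA.supportFun_apply,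
    hB.supportFun_apply, Set.image_add, csSup_add (hA.nonempty.image _) (hA.bddAbove_image _)
    (hB.nonempty.image _) (hB.bddAbove_image _)]

theorem supportFun_smul {A : Set X} (hA : IsConvexBody A) {r : ℝ} (hr : 0 ≤ r) :
    supportFun (r • A) = r • supportFun A := by
  ext f
  rw [lp.coeFn_smul, Pi.smul_apply, (hA.smul r).supportFun_apply, hA.supportFun_apply,
    ← Real.sSup_smul_of_nonneg hr, image_smul_set]

theorem isConvexBody_sum {ι : Type*} (s : Finset ι) {A : ι → Set X}
    (hA : ∀ i, IsConvexBody (A i)) :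
    IsConvexBody (∑ i ∈ s, A i) ∧ supportFun (∑ i ∈ s, A i) = ∑ i ∈ s, supportFun (A i) := by
  classical
  induction s using Finset.induction_on with
  | empty => simpa using ⟨isConvexBody_zero, supportFun_zero⟩
  | insert i s hi ih =>
    rw [Finset.sum_insert hi, Finset.sum_insert hi]
    exact ⟨(hA i).add ih.1, by rw [supportFun_add (hA i) ih.1, ih.2]⟩

/-- Otherwise an open ball about `a` misses `B`, and a separating functional, normalised, gives
support functions that differ by more than the norm allows. -/
theorem infDist_le_norm_supportFun_sub {A B : Set X} (hA : IsConvexBody A) (hB : IsConvexBody B)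
    {a : X} (ha : a ∈ A) : Metric.infDist a B ≤ ‖supportFun A - supportFun B‖ := by
  by_contra! h
  obtain ⟨r, hr, hrB⟩ := exists_between h
  have hr0 : 0 < r := (norm_nonneg _).trans_lt hr
  have hd : Disjoint (Metric.ball a (Metric.infDist a B)) B := Metric.disjoint_ball_infDist
  obtain ⟨f, u, hfa, hfB⟩ :=
    geometric_hahn_banach_open (convex_ball a _) Metric.isOpen_ball hB.convex hd
  have hf0 : f ≠ 0 := by
    rintro rfl
    obtain ⟨b, hb⟩ := hB.nonempty
    have h₁ := hfa a (Metric.mem_ball_self (hr0.trans hrB))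
    have h₂ := hfB b hb
    simp only [_root_.zero_apply] at h₁ h₂
    linarith
  have hfn : 0 < ‖f‖ := norm_pos_iff.2 hf0
  -- Since `r < infDist a B`, the closed ball of radius `r` about `a` lies in the separated open
  -- ball, where `f < u`.
  have key : f a + r * ‖f‖ ≤ u := by
    have hle : ‖f‖ ≤ (u - f a) / r := by
      refine ContinuousLinearMap.opNorm_bound_of_ball_bound hr0 _ f fun z hz => ?_
      have hz' : ‖z‖ < Metric.infDist a B := (mem_closedBall_zero_iff.1 hz).trans_lt hrB
      have h₁ := hfa (a + z) (by simpa using hz')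
      have h₂ := hfa (a - z) (by simpa using hz')
      rw [map_add] at h₁
      rw [map_sub] at h₂
      rw [Real.norm_eq_abs, abs_le]
      constructor <;> linarith
    rw [le_div_iff₀ hr0] at hle
    linarith
  -- The sign is reversed because `f` is small near `a` and large on `B`, while the supremum over
  -- `A` must exceed that over `B`.
  let g : {f : X →L[ℝ] ℝ // ‖f‖ ≤ 1} := ⟨-(‖f‖⁻¹ • f), by
    rw [norm_neg, norm_smul, norm_inv, norm_norm, inv_mul_cancel₀ hfn.ne']⟩
  have hg (x) : g.1 x = -(‖f‖⁻¹ * f x) := rfl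
  have h₁ : g.1 a ≤ supportFun A g := by
    rw [hA.supportFun_apply]
    exact le_csSup (hA.bddAbove_image _) (Set.mem_image_of_mem _ ha)
  have h₂ : supportFun B g ≤ g.1 a - r := by
    rw [hB.supportFun_apply]
    refine csSup_le (hB.nonempty.image _) ?_
    rintro _ ⟨b, hb, rfl⟩
    have h₃ : ‖f‖⁻¹ * (f a + r * ‖f‖) ≤ ‖f‖⁻¹ * f b :=
      mul_le_mul_of_nonneg_left (key.trans (hfB b hb)) (inv_nonneg.2 hfn.le)
    have h₄ : ‖f‖⁻¹ * (f a + r * ‖f‖) = ‖f‖⁻¹ * f a + r := by field_simp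
    rw [hg, hg]
    linarith
  have h₅ := lp.norm_apply_le_norm ENNReal.top_ne_zero (supportFun A - supportFun B) g
  rw [lp.coeFn_sub, Pi.sub_apply] at h₅
  have h₆ := le_abs_self (supportFun A g - supportFun B g)
  rw [Real.norm_eq_abs] at h₅
  linarith

theorem supportFun_apply_le {A B : Set X} (hA : IsConvexBody A) (hB : IsConvexBody B)
    (f : {f : X →L[ℝ] ℝ // ‖f‖ ≤ 1}) :
    supportFun A f ≤ supportFun B f + Metric.hausdorffDist A B := by
  rw [hA.supportFun_apply, hB.supportFun_apply]
  refine csSup_le (hA.nonempty.image _) ?_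
  rintro _ ⟨a, ha, rfl⟩
  refine le_of_forall_pos_le_add fun ε hε => ?_
  obtain ⟨b, hb, hab⟩ := Metric.exists_dist_lt_of_hausdorffDist_lt ha
    (lt_add_of_pos_right (Metric.hausdorffDist A B) hε)
    (Metric.hausdorffEDist_ne_top_of_nonempty_of_bounded hA.nonempty hB.nonempty
      hA.isBounded hB.isBounded)
  have h₁ : f.1 b ≤ sSup (f.1 '' B) :=
    le_csSup (hB.bddAbove_image _) (Set.mem_image_of_mem _ hb)
  have h₂ : f.1 (a - b) ≤ dist a b := by
    rw [dist_eq_norm]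
    exact (le_abs_self _).trans ((f.1.le_of_opNorm_le f.2 _).trans (by simp))
  rw [map_sub] at h₂
  linarith

/-- The Rådström–Hörmander embedding is isometric for the Hausdorff distance. -/
theorem hausdorffDist_eq_norm_supportFun_sub {A B : Set X} (hA : IsConvexBody A)
    (hB : IsConvexBody B) :
    Metric.hausdorffDist A B = ‖supportFun A - supportFun B‖ := by
  refine le_antisymm ?_ ?_
  · refine Metric.hausdorffDist_le_of_infDist (norm_nonneg _)
      (fun a ha => infDist_le_norm_supportFun_sub hA hB ha) fun b hb => ?_
    rw [norm_sub_rev]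
    exact infDist_le_norm_supportFun_sub hB hA hb
  · refine lp.norm_le_of_forall_le Metric.hausdorffDist_nonneg fun f => ?_
    have h₁ := supportFun_apply_le hA hB f
    have h₂ := supportFun_apply_le hB hA f
    rw [Metric.hausdorffDist_comm] at h₂
    rw [lp.coeFn_sub, Pi.sub_apply, Real.norm_eq_abs, abs_le]
    constructor <;> linarith

end Support

/-! ### Gauges and the variational McShane property of Bochner integrable functions -/

theorem exists_gauge_of_eventually {P : unitInterval → unitInterval → Prop}
    (h : ∀ t, ∀ᶠ s in 𝓝 t, P t s) :
    ∃ δ, IsGauge δ ∧ ∀ π : TaggedPartition, π.IsFine δ →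
      ∀ i, ∀ s ∈ (π.I i : Set unitInterval), P (π.tag i) s := by
  have h' (t) : ∃ r > 0, ∀ s ∈ Metric.closedBall t r, P t s :=
    Metric.nhds_basis_closedBall.eventually_iff.1 (h t)
  choose δ hδ hP using h'
  refine ⟨δ, hδ, fun π hπ i s hs => hP _ _ ?_⟩
  rw [Metric.mem_closedBall, Subtype.dist_eq, Real.dist_eq, abs_le]
  obtain ⟨h₁, h₂⟩ := hπ i s hs
  constructor <;> linarith

theorem IsGauge.min {δ δ' : unitInterval → ℝ} (h : IsGauge δ) (h' : IsGauge δ') :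
    IsGauge fun t => min (δ t) (δ' t) :=
  fun t => lt_min (h t) (h' t)

theorem TaggedPartition.IsFine.mono {π : TaggedPartition} {δ δ' : unitInterval → ℝ}
    (h : π.IsFine δ) (hδ : ∀ t, δ t ≤ δ' t) : π.IsFine δ' := fun i s hs => by
  obtain ⟨h₁, h₂⟩ := h i s hs
  have := hδ (π.tag i)
  constructor <;> linarith

theorem Interval.length_nonneg (I : Interval) : 0 ≤ I.length :=
  sub_nonneg.2 I.fst_le_snd

theorem Interval.volume_coe (I : Interval) :
    volume (I : Set unitInterval) = ENNReal.ofReal I.length := by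
  rw [NonemptyInterval.coe_def, unitInterval.volume_Icc]
  rfl

theorem Interval.volume_real_coe (I : Interval) :
    volume.real (I : Set unitInterval) = I.length := by
  rw [Measure.real, I.volume_coe, ENNReal.toReal_ofReal I.length_nonneg]

theorem Interval.measurableSet_coe (I : Interval) : MeasurableSet (I : Set unitInterval) := by
  rw [NonemptyInterval.coe_def]
  exact measurableSet_Icc

theorem Interval.ae_eq_Ioo (I : Interval) :
    (I : Set unitInterval) =ᵐ[volume] Set.Ioo I.fst I.snd := by
  rw [NonemptyInterval.coe_def]
  refine (ae_eq_of_subset_of_measure_ge Set.Ioo_subset_Icc_self ?_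
    measurableSet_Ioo.nullMeasurableSet (measure_ne_top _ _)).symm
  rw [unitInterval.volume_Icc, unitInterval.volume_Ioo]

theorem IntervalPartition.pairwise_aedisjoint (P : IntervalPartition) :
    Pairwise (Function.onFun (AEDisjoint volume) fun i => (P.I i : Set unitInterval)) :=
  fun _ _ hij => (P.nonoverlapping hij).aedisjoint.congr
    (P.I _).ae_eq_Ioo (P.I _).ae_eq_Ioo

theorem IntervalPartition.sum_setLIntegral (P : IntervalPartition) (u : unitInterval → ENNReal) :
    ∑ i, ∫⁻ s in (P.I i : Set unitInterval), u s = ∫⁻ s, u s := by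
  rw [← tsum_fintype (L := .unconditional _), ← lintegral_iUnion₀
    (fun i => (P.I i).measurableSet_coe.nullMeasurableSet) P.pairwise_aedisjoint, P.cover,
    setLIntegral_univ]

section Vector

variable {E : Type*} [NormedAddCommGroup E] [NormedSpace ℝ E]

theorem IntervalPartition.sum_setIntegral (P : IntervalPartition) {f : unitInterval → E}
    (hf : Integrable f) :
    ∑ i, ∫ s in (P.I i : Set unitInterval), f s = ∫ s, f s := by
  rw [← tsum_fintype (L := .unconditional _), ← integral_iUnion_ae
    (fun i => (P.I i).measurableSet_coe.nullMeasurableSet) P.pairwise_aedisjoint hf.integrableOn,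
    P.cover, setIntegral_univ]

/-- A Vitali–Carathéodory argument. Take `g` continuous and close to `f` in mean, and a lower
semicontinuous `u > ‖f - g‖` of almost the same integral. Near each tag `t`, `u` stays above `‖f t -
g t‖`, so the uncontrolled errors at the tags are dominated by `∫ u`, wherever the tags lie. The
four quarters of `ε` are: `‖f - g‖` once, the oscillation of `g` once, and `u` twice. -/
theorem exists_gauge_sum_lintegral_le {f : unitInterval → E} (hf : Integrable f)
    {ε : ENNReal} (hε : ε ≠ 0) :
    ∃ δ, IsGauge δ ∧ ∀ π : TaggedPartition, π.IsFine δ →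
      ∑ i, ∫⁻ s in (π.I i : Set unitInterval), ‖f s - f (π.tag i)‖ₑ ≤ ε := by
  have hε' : ε / 4 ≠ 0 := by simpa [ENNReal.div_eq_zero_iff] using hε
  obtain ⟨g, hg, hgi⟩ := hf.exists_boundedContinuous_lintegral_sub_le hε'
  have hh : AEMeasurable (fun s => ‖f s - g s‖₊) volume :=
    (hf.1.sub hgi.1).nnnorm.aemeasurable
  obtain ⟨u, hu, hul, hui⟩ :=
    exists_lt_lowerSemicontinuous_lintegral_ge_of_aemeasurable volume _ hh hε'
  obtain ⟨δ, hδ, hP⟩ := exists_gauge_of_eventually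
    (P := fun t s => ‖g t - g s‖ₑ < ε / 4 ∧ ‖f t - g t‖ₑ < u s) fun t => by
      refine Eventually.and ?_ (hul t _ (hu t))
      have hc : ContinuousAt (fun s => ‖g t - g s‖ₑ) t := by fun_prop
      exact hc.eventually_lt_const (by simpa using pos_iff_ne_zero.2 hε')
  refine ⟨δ, hδ, fun π hπ => ?_⟩
  calc
    _ ≤ ∑ i, ∫⁻ s in (π.I i : Set unitInterval), ((‖f s - g s‖ₑ + ε / 4) + u s) := by
      refine Finset.sum_le_sum fun i _ => setLIntegral_mono' (π.I i).measurableSet_coe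
        fun s hs => ?_
      obtain ⟨h₁, h₂⟩ := hP π hπ i s hs
      have : f s - f (π.tag i) =
          (f s - g s) - (g (π.tag i) - g s) - (f (π.tag i) - g (π.tag i)) := by abel
      rw [this]
      exact enorm_sub_le.trans (add_le_add (enorm_sub_le.trans (add_le_add le_rfl h₁.le)) h₂.le)
    _ = ∫⁻ s, ((‖f s - g s‖ₑ + ε / 4) + u s) := π.sum_setLIntegral _
    _ = (∫⁻ s, ‖f s - g s‖ₑ) + ε / 4 + ∫⁻ s, u s := by
      rw [lintegral_add_right _ hul.measurable, lintegral_add_right _ measurable_const]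
      simp
    _ ≤ ε / 4 + ε / 4 + (ε / 4 + ε / 4) := by
      exact add_le_add (add_le_add hg le_rfl) (hui.trans (add_le_add hg le_rfl))
    _ = ε := by
      have : ε / 4 = ε / 2 / 2 := by
        rw [ENNReal.div_eq_inv_mul, ENNReal.div_eq_inv_mul, ENNReal.div_eq_inv_mul, ← mul_assoc,
          ← ENNReal.mul_inv (by simp) (by simp)]
        norm_num
      rw [this, ENNReal.add_halves, ENNReal.add_halves]

/-- A Bochner integrable function is variationally McShane integrable. -/
theorem exists_gauge_sum_norm_lt [CompleteSpace E] {f : unitInterval → E} (hf : Integrable f)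
    {ε : ℝ} (hε : 0 < ε) :
    ∃ δ, IsGauge δ ∧ ∀ π : TaggedPartition, π.IsFine δ →
      ∑ i, ‖(∫ s in (π.I i : Set unitInterval), f s) - (π.I i).length • f (π.tag i)‖ < ε := by
  obtain ⟨δ, hδ, h⟩ := exists_gauge_sum_lintegral_le hf
    (ε := ENNReal.ofReal (ε / 2)) (by simpa using hε)
  refine ⟨δ, hδ, fun π hπ => ?_⟩
  have hle (i) : ‖(∫ s in (π.I i : Set unitInterval), f s) - (π.I i).length • f (π.tag i)‖ₑ ≤
      ∫⁻ s in (π.I i : Set unitInterval), ‖f s - f (π.tag i)‖ₑ := by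
    rw [← (π.I i).volume_real_coe, ← setIntegral_const, ← integral_sub hf.integrableOn
      (integrable_const _)]
    exact enorm_integral_le_lintegral_enorm _
  have hsum := (Finset.sum_le_sum fun i _ => hle i).trans (h π hπ)
  simp_rw [← ofReal_norm] at hsum
  rw [← ENNReal.ofReal_sum_of_nonneg fun _ _ => norm_nonneg _,
    ENNReal.ofReal_le_ofReal_iff (by positivity)] at hsum
  linarith

/-- `A` is the McShane integral of the vector-valued function `f`. -/
def IsMcShaneLimit (f : unitInterval → E) (A : E) : Prop :=
  ∀ ε : ℝ, 0 < ε → ∃ δ, IsGauge δ ∧ ∀ π : TaggedPartition, π.IsFine δ →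
    ‖A - ∑ i, (π.I i).length • f (π.tag i)‖ < ε

/-- `A` is the Henstock integral of the vector-valued function `f`. -/
def IsHenstockLimit (f : unitInterval → E) (A : E) : Prop :=
  ∀ ε : ℝ, 0 < ε → ∃ δ, IsGauge δ ∧ ∀ π : TaggedPartition, π.IsPerron → π.IsFine δ →
    ‖A - ∑ i, (π.I i).length • f (π.tag i)‖ < ε

theorem IsMcShaneLimit.isHenstockLimit {f : unitInterval → E} {A : E} (h : IsMcShaneLimit f A) :
    IsHenstockLimit f A := fun ε hε =>
  let ⟨δ, hδ, H⟩ := h ε hε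
  ⟨δ, hδ, fun π _ hπ => H π hπ⟩

/-- Cousin's lemma supplies a partition fine for both gauges at once. -/
theorem IsHenstockLimit.unique {f : unitInterval → E} {A B : E} (hA : IsHenstockLimit f A)
    (hB : IsHenstockLimit f B) : A = B := by
  rw [← sub_eq_zero, ← norm_le_zero_iff]
  refine le_of_forall_pos_le_add fun ε hε => ?_
  obtain ⟨δ, hδ, h⟩ := hA (ε / 2) (half_pos hε)
  obtain ⟨δ', hδ', h'⟩ := hB (ε / 2) (half_pos hε)
  obtain ⟨π, hp, hf⟩ := exists_isPerron_isFine (hδ.min hδ')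
  have h₁ := h π hp (hf.mono fun t => min_le_left _ _)
  have h₂ := h' π hp (hf.mono fun t => min_le_right _ _)
  rw [norm_sub_rev] at h₂
  have h₃ := norm_sub_le_norm_sub_add_norm_sub A (∑ i, (π.I i).length • f (π.tag i)) B
  linarith

theorem isMcShaneLimit_integral [CompleteSpace E] {f : unitInterval → E} (hf : Integrable f) :
    IsMcShaneLimit f (∫ s, f s) := fun ε hε => by
  obtain ⟨δ, hδ, h⟩ := exists_gauge_sum_norm_lt hf hε
  refine ⟨δ, hδ, fun π hπ => lt_of_le_of_lt ?_ (h π hπ)⟩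
  rw [← π.sum_setIntegral hf, ← Finset.sum_sub_distrib]
  exact norm_sum_le _ _

end Vector

/-! ### Dyadic cells and a covering theorem -/

/-- The dyadic point `k / 2ⁿ`, clipped to `[0,1]`. -/
noncomputable def dyadic (n k : ℕ) : unitInterval :=
  Set.projIcc 0 1 zero_le_one ((k : ℝ) / 2 ^ n)

theorem dyadic_mono (n : ℕ) : Monotone (dyadic n) := fun k l h =>
  Set.monotone_projIcc _ (by gcongr)

theorem coe_dyadic {n k : ℕ} (h : k ≤ 2 ^ n) : (dyadic n k : ℝ) = k / 2 ^ n := by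
  have h' : (k : ℝ) / 2 ^ n ≤ 1 := (div_le_one (by positivity)).2 (by exact_mod_cast h)
  rw [dyadic, Set.projIcc_of_mem zero_le_one ⟨by positivity, h'⟩]

theorem dyadic_zero (n : ℕ) : dyadic n 0 = 0 :=
  Subtype.ext (by simp [coe_dyadic])

theorem dyadic_eq_one {n k : ℕ} (h : 2 ^ n ≤ k) : dyadic n k = 1 := by
  refine Set.projIcc_of_right_le _ ?_
  rw [one_le_div (by positivity)]
  exact_mod_cast h

theorem dyadic_add_mul (n m k : ℕ) : dyadic (n + m) (k * 2 ^ m) = dyadic n k := by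
  rw [dyadic, dyadic]
  congr 1
  push_cast
  rw [pow_add, mul_div_mul_right _ _ (by positivity)]

/-- The dyadic interval `[k / 2ⁿ, (k + 1) / 2ⁿ]`. -/
noncomputable def cell (n k : ℕ) : Interval :=
  ⟨(dyadic n k, dyadic n (k + 1)), dyadic_mono n k.le_succ⟩

theorem length_cell {n k : ℕ} (h : k < 2 ^ n) : (cell n k).length = (2 ^ n)⁻¹ := by
  change (dyadic n (k + 1) : ℝ) - dyadic n k = _
  rw [coe_dyadic h, coe_dyadic h.le]
  push_cast
  ring

theorem length_cell_of_le {n k : ℕ} (h : 2 ^ n ≤ k) : (cell n k).length = 0 := by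
  change (dyadic n (k + 1) : ℝ) - dyadic n k = _
  rw [dyadic_eq_one h, dyadic_eq_one (h.trans k.le_succ), sub_self]

theorem fst_cell_lt_snd {n k : ℕ} (h : k < 2 ^ n) : (cell n k).fst < (cell n k).snd := by
  have h₁ := length_cell h
  have h₂ : (0 : ℝ) < (2 ^ n)⁻¹ := by positivity
  rw [← h₁] at h₂
  exact Subtype.coe_lt_coe.1 (sub_pos.1 h₂)

theorem cell_subset_cell {n m j k : ℕ} (h : j / 2 ^ m = k) :
    (cell (n + m) j : Set unitInterval) ⊆ cell n k := by
  rw [NonemptyInterval.coe_def, NonemptyInterval.coe_def]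
  have hj := Nat.div_add_mod j (2 ^ m)
  have hlt := Nat.mod_lt j (Nat.two_pow_pos m)
  rw [h] at hj
  refine Set.Icc_subset_Icc ?_ ?_
  · change dyadic n k ≤ dyadic (n + m) j
    rw [← dyadic_add_mul n m]
    exact dyadic_mono _ (h ▸ Nat.div_mul_le_self j _)
  · change dyadic (n + m) (j + 1) ≤ dyadic n (k + 1)
    rw [← dyadic_add_mul n m]
    exact dyadic_mono _ (by nlinarith)

/-- The index of a dyadic interval of order `n` that contains `t`. -/
noncomputable def cellIndex (n : ℕ) (t : unitInterval) : ℕ := ⌊(2 : ℝ) ^ n * t⌋₊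

theorem mem_cell_cellIndex (n : ℕ) (t : unitInterval) : t ∈ cell n (cellIndex n t) := by
  have h0 : (0 : ℝ) ≤ 2 ^ n * t := mul_nonneg (by positivity) t.2.1
  have h2 : (0 : ℝ) < 2 ^ n := by positivity
  have ht : t = Set.projIcc 0 1 zero_le_one (t : ℝ) := (Set.projIcc_val _ t).symm
  constructor
  · change dyadic n _ ≤ t
    rw [ht]
    refine Set.monotone_projIcc _ ?_
    rw [div_le_iff₀' h2, Set.projIcc_val]
    exact Nat.floor_le h0
  · change t ≤ dyadic n _
    rw [ht]
    refine Set.monotone_projIcc _ ?_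
    rw [le_div_iff₀' h2, Set.projIcc_val]
    push_cast
    exact (Nat.lt_floor_add_one _).le

theorem cellIndex_le (n : ℕ) (t : unitInterval) : cellIndex n t ≤ 2 ^ n := by
  refine Nat.floor_le_of_le ?_
  push_cast
  exact mul_le_of_le_one_right (by positivity) t.2.2

theorem cellIndex_lt (n : ℕ) {t : unitInterval} (ht : t < 1) : cellIndex n t < 2 ^ n := by
  refine (Nat.floor_lt (mul_nonneg (by positivity) t.2.1)).2 ?_
  push_cast
  exact mul_lt_of_lt_one_right (by positivity) ht

theorem measurable_cellIndex (n : ℕ) : Measurable (cellIndex n) :=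
  Nat.measurable_floor.comp (measurable_subtype_coe.const_mul _)

theorem tendsto_inv_two_pow : Tendsto (fun n : ℕ => ((2 : ℝ) ^ n)⁻¹) atTop (𝓝 0) :=
  tendsto_inv_atTop_zero.comp (tendsto_pow_atTop_atTop_of_one_lt one_lt_two)

theorem hasDivision_cells {p : Interval → unitInterval → Prop} {w : Interval → unitInterval → ℝ}
    {n : ℕ} (tag : ℕ → unitInterval) (h : ∀ k < 2 ^ n, p (cell n k) (tag k)) :
    HasDivision p w 0 1 (∑ k ∈ Finset.range (2 ^ n), w (cell n k) (tag k)) := by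
  have key (k : ℕ) (hk : k + 1 ≤ 2 ^ n) : HasDivision p w (dyadic n 0) (dyadic n (k + 1))
      (∑ k ∈ Finset.range (k + 1), w (cell n k) (tag k)) := by
    induction k with
    | zero =>
      exact HasDivision.single (I := cell n 0) (fst_cell_lt_snd hk) (h 0 hk) (by simp)
    | succ k ih =>
      rw [Finset.sum_range_succ]
      exact (ih (k.succ.le_succ.trans hk)).append (dyadic_mono n (Nat.zero_le _))
        (dyadic_mono n (Nat.le_succ _))
        (HasDivision.single (I := cell n (k + 1)) (fst_cell_lt_snd hk) (h _ hk) le_rfl)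
  have h1 := Nat.one_le_two_pow (n := n)
  have := key (2 ^ n - 1) (by omega)
  rwa [Nat.sub_add_cancel h1, dyadic_zero, dyadic_eq_one le_rfl] at this

/-- A stopping argument on the dyadic tree: each branch stops at its first cell that has a fine tag
with `w` at least `η` times the length. `W` is the union of the stopped cells, which are maximal and
hence nonoverlapping. Cells at depth `d` that have not stopped are divided by Cousin's lemma, where
`w ≥ 0` suffices. -/
theorem exists_hasDivision_of_cells {δ : unitInterval → ℝ} (hδ : IsGauge δ)
    {w : Interval → unitInterval → ℝ} (hw : ∀ I t, 0 ≤ w I t) {η : ℝ} (hη : 0 ≤ η) (d : ℕ) :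
    ∀ n k, k < 2 ^ n → ∃ W : Set unitInterval,
      HasDivision (FinePerron δ) w (dyadic n k) (dyadic n (k + 1)) (η * volume.real W) ∧
      ∀ m ≤ d, ∀ j, j / 2 ^ m = k →
        (∃ t, FinePerron δ (cell (n + m) j) t ∧
          η * (cell (n + m) j).length ≤ w (cell (n + m) j) t) →
        (cell (n + m) j : Set unitInterval) ⊆ W := by
  induction d with
  | zero =>
    intro n k hk
    by_cases hB : ∃ t, FinePerron δ (cell n k) t ∧ η * (cell n k).length ≤ w (cell n k) t
    · obtain ⟨t, ht, hwt⟩ := hB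
      refine ⟨cell n k, HasDivision.single (I := cell n k) (fst_cell_lt_snd hk) ht
        (by rwa [Interval.volume_real_coe]), fun m _ j hj _ => cell_subset_cell hj⟩
    · refine ⟨∅, ?_, ?_⟩
      · rw [measureReal_empty, mul_zero]
        exact hasDivision_finePerron hδ (fst_cell_lt_snd hk) hw
      intro m hm j hj h
      obtain rfl : m = 0 := by omega
      obtain rfl : j = k := by simpa using hj
      exact absurd h hB
  | succ d ih =>
    intro n k hk
    by_cases hB : ∃ t, FinePerron δ (cell n k) t ∧ η * (cell n k).length ≤ w (cell n k) t
    · obtain ⟨t, ht, hwt⟩ := hB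
      refine ⟨cell n k, HasDivision.single (I := cell n k) (fst_cell_lt_snd hk) ht
        (by rwa [Interval.volume_real_coe]), fun m _ j hj _ => cell_subset_cell hj⟩
    · obtain ⟨W₁, hW₁, h₁⟩ := ih (n + 1) (k * 2) (by rw [pow_succ]; omega)
      obtain ⟨W₂, hW₂, h₂⟩ := ih (n + 1) (k * 2 + 1) (by rw [pow_succ]; omega)
      have e₁ : dyadic (n + 1) (k * 2) = dyadic n k := by
        simpa using dyadic_add_mul n 1 k
      have e₂ : dyadic (n + 1) (k * 2 + 1 + 1) = dyadic n (k + 1) := by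
        simpa [add_mul] using dyadic_add_mul n 1 (k + 1)
      refine ⟨W₁ ∪ W₂, ?_, ?_⟩
      · rw [← e₁, ← e₂]
        refine (hW₁.append (dyadic_mono _ (by omega)) (dyadic_mono _ (by omega)) hW₂).mono ?_
        rw [← mul_add]
        exact mul_le_mul_of_nonneg_left (measureReal_union_le _ _) hη
      · intro m hm j hj h
        rcases m with _ | m
        · obtain rfl : j = k := by simpa using hj
          exact absurd h hB
        have e : n + (m + 1) = n + 1 + m := by ring
        rw [e] at h ⊢
        have hj' : j / 2 ^ m / 2 = k := by rw [Nat.div_div_eq_div_mul, ← pow_succ, hj]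
        have hor : j / 2 ^ m = k * 2 ∨ j / 2 ^ m = k * 2 + 1 := by omega
        rcases hor with h' | h'
        · exact (h₁ m (by omega) j h' h).trans Set.subset_union_left
        · exact (h₂ m (by omega) j h' h).trans Set.subset_union_right

/-- A covering theorem: if the sums of `w` over fine Perron partitions are small, then at almost
every point `t` the ratios `w (I, t) / |I|` tend to `0` along the dyadic intervals `I ∋ t`. -/
theorem volume_frequently_cell_eq_zero {w : Interval → unitInterval → ℝ} (hw : ∀ I t, 0 ≤ w I t)
    (h : ∀ ε : ℝ, 0 < ε → ∃ δ, IsGauge δ ∧ ∀ π : TaggedPartition, π.IsPerron → π.IsFine δ →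
      ∑ i, w (π.I i) (π.tag i) < ε) {η : ℝ} (hη : 0 < η) :
    volume {t : unitInterval | t < 1 ∧ ∃ᶠ n in atTop,
      η * (cell n (cellIndex n t)).length ≤ w (cell n (cellIndex n t)) t} = 0 := by
  have key (ε : ℝ) (hε : 0 < ε) : volume {t : unitInterval | t < 1 ∧ ∃ᶠ n in atTop,
      η * (cell n (cellIndex n t)).length ≤ w (cell n (cellIndex n t)) t} ≤
      ENNReal.ofReal ε := by
    obtain ⟨δ, hδ, hsum⟩ := h (η * ε) (by positivity)
    -- The order of the cells is capped at `d` because a division is finite; continuity of the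
    -- measure from below removes the cap.
    let U : ℕ → Set unitInterval := fun d => {t | t < 1 ∧ ∃ m ≤ d,
      FinePerron δ (cell m (cellIndex m t)) t ∧
      η * (cell m (cellIndex m t)).length ≤ w (cell m (cellIndex m t)) t}
    have hU : Monotone U := fun d d' hd t ⟨ht, m, hm, h⟩ => ⟨ht, m, hm.trans hd, h⟩
    have hUd (d) : volume (U d) ≤ ENNReal.ofReal ε := by
      obtain ⟨W, hW, hsub⟩ := exists_hasDivision_of_cells hδ hw hη.le d 0 0 (by simp)
      rw [dyadic_zero, dyadic_eq_one (by simp)] at hW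
      obtain ⟨π, hπ, hle⟩ := hW.exists_taggedPartition
      have hlt := hsum π (fun i => (hπ i).1) fun i => (hπ i).2
      have hWε : volume.real W ≤ ε := le_of_mul_le_mul_left (hle.trans hlt.le) hη
      refine (measure_mono ?_).trans (ENNReal.le_ofReal_iff_toReal_le (measure_ne_top _ _)
        hε.le |>.2 hWε)
      rintro t ⟨ht, m, hm, hb⟩
      have := hsub m hm (cellIndex m t) (Nat.div_eq_of_lt (cellIndex_lt m ht))
        ⟨t, by simpa using hb⟩
      rw [zero_add] at this
      exact this (mem_cell_cellIndex m t)
    refine (measure_mono ?_).trans ((hU.measure_iUnion (μ := volume)).le.trans (iSup_le hUd))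
    rintro t ⟨ht, hfreq⟩
    -- A bad cell shorter than `δ t` and containing `t` is automatically fine with tag `t`.
    obtain ⟨m, hm, hmδ⟩ :=
      (hfreq.and_eventually (tendsto_inv_two_pow.eventually_lt_const (hδ t))).exists
    refine Set.mem_iUnion.2 ⟨m, ht, m, le_rfl, ⟨mem_cell_cellIndex m t, fun s hs => ?_⟩, hm⟩
    have hl := length_cell (cellIndex_lt m ht)
    have hl' : ((cell m (cellIndex m t)).snd : ℝ) - (cell m (cellIndex m t)).fst = _ := hl
    have h₁ : ((cell m (cellIndex m t)).fst : ℝ) ≤ t := (mem_cell_cellIndex m t).1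
    have h₂ : (t : ℝ) ≤ (cell m (cellIndex m t)).snd := (mem_cell_cellIndex m t).2
    have h₃ : ((cell m (cellIndex m t)).fst : ℝ) ≤ s := hs.1
    have h₄ : (s : ℝ) ≤ (cell m (cellIndex m t)).snd := hs.2
    constructor <;> linarith
  refine le_antisymm (ENNReal.le_of_forall_pos_le_add fun ε hε _ => ?_) zero_le
  simpa using key ε hε

/-! ### Dyadic differentiation and Bochner integrability -/

section Vector

variable {E : Type*} [NormedAddCommGroup E] [NormedSpace ℝ E]
  {f : unitInterval → E} {φ : Interval → E}

/-- The difference quotients of a variational primitive along dyadic intervals converge to the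
integrand almost everywhere. -/
theorem ae_tendsto_cell
    (h : ∀ ε : ℝ, 0 < ε → ∃ δ, IsGauge δ ∧ ∀ π : TaggedPartition, π.IsPerron → π.IsFine δ →
      ∑ i, ‖φ (π.I i) - (π.I i).length • f (π.tag i)‖ < ε) :
    ∀ᵐ t : unitInterval, Tendsto (fun n : ℕ => (2 : ℝ) ^ n • φ (cell n (cellIndex n t))) atTop
      (𝓝 (f t)) := by
  -- The point `1` is discarded since its cells, of index `2 ^ n`, are degenerate.
  have h1 : ∀ᵐ t : unitInterval, t ≠ 1 := by
    have : volume (Set.Icc (1 : unitInterval) 1) = 0 := by simp [-Set.Icc_self]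
    rw [Set.Icc_self] at this
    exact compl_mem_ae_iff.2 this
  have h2 : ∀ᵐ t : unitInterval, ∀ N : ℕ, ¬ (t < 1 ∧ ∃ᶠ n in atTop,
      1 / ((N : ℝ) + 1) * (cell n (cellIndex n t)).length ≤
        ‖φ (cell n (cellIndex n t)) - (cell n (cellIndex n t)).length • f t‖) :=
    ae_all_iff.2 fun N => compl_mem_ae_iff.2 <| volume_frequently_cell_eq_zero
      (w := fun I t => ‖φ I - I.length • f t‖) (fun _ _ => norm_nonneg _) h Nat.one_div_pos_of_nat
  filter_upwards [h1, h2] with t ht ht'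
  have htlt : t < 1 := lt_of_le_of_ne unitInterval.le_one' ht
  rw [Metric.tendsto_nhds]
  intro η hη
  obtain ⟨N, hN⟩ := exists_nat_one_div_lt hη
  have hev := not_frequently.1 fun hf => ht' N ⟨htlt, hf⟩
  filter_upwards [hev] with n hn
  rw [length_cell (cellIndex_lt n htlt), not_le] at hn
  have h2n : (0 : ℝ) < 2 ^ n := by positivity
  have e : (2 : ℝ) ^ n • φ (cell n (cellIndex n t)) - f t =
      (2 : ℝ) ^ n • (φ (cell n (cellIndex n t)) - ((2 : ℝ) ^ n)⁻¹ • f t) := by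
    rw [smul_sub, smul_inv_smul₀ h2n.ne']
  rw [dist_eq_norm, e, norm_smul, Real.norm_of_nonneg h2n.le]
  rw [← div_eq_mul_inv, lt_div_iff₀' h2n] at hn
  exact hn.trans hN

/-- The difference quotients are step functions, so their almost everywhere limit `f` is strongly
measurable even in a nonseparable space. Their norms have integrals at most the dyadic sums, and
Fatou's lemma concludes. -/
theorem integrable_of_sum_cells_le
    (h : ∀ ε : ℝ, 0 < ε → ∃ δ, IsGauge δ ∧ ∀ π : TaggedPartition, π.IsPerron → π.IsFine δ →
      ∑ i, ‖φ (π.I i) - (π.I i).length • f (π.tag i)‖ < ε) {C : ENNReal} (hC : C ≠ ⊤)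
    (hφ : ∀ᶠ n : ℕ in atTop, ∑ k ∈ Finset.range (2 ^ n), ‖φ (cell n k)‖ₑ ≤ C) :
    Integrable f := by
  have hae := ae_tendsto_cell h
  have hmeas (n : ℕ) : StronglyMeasurable
      fun t => (2 : ℝ) ^ n • φ (cell n (cellIndex n t)) :=
    (StronglyMeasurable.of_discrete (f := fun k : ℕ => (2 : ℝ) ^ n • φ (cell n k))).comp_measurable
      (measurable_cellIndex n)
  refine ⟨aestronglyMeasurable_of_tendsto_ae atTop (fun n => (hmeas n).aestronglyMeasurable) hae,
    ?_⟩
  have hn (n : ℕ) : ∫⁻ t, ‖(2 : ℝ) ^ n • φ (cell n (cellIndex n t))‖ₑ ≤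
      ∑ k ∈ Finset.range (2 ^ n), ‖φ (cell n k)‖ₑ := by
    calc
      -- The extra index `2 ^ n` accounts for `t = 1`; its cell has length `0` and drops out below.
      _ ≤ ∫⁻ t, ∑ k ∈ Finset.range (2 ^ n + 1),
          (cell n k : Set unitInterval).indicator (fun _ => ‖(2 : ℝ) ^ n • φ (cell n k)‖ₑ) t := by
        refine lintegral_mono fun t => ?_
        have ht : t ∈ (cell n (cellIndex n t) : Set unitInterval) := mem_cell_cellIndex n t
        refine le_trans (le_of_eq ?_) (Finset.single_le_sum_of_canonicallyOrdered
          (Finset.mem_range_succ_iff.2 (cellIndex_le n t)))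
        rw [Set.indicator_of_mem ht]
      _ = ∑ k ∈ Finset.range (2 ^ n + 1),
          ‖(2 : ℝ) ^ n • φ (cell n k)‖ₑ * ENNReal.ofReal (cell n k).length := by
        rw [lintegral_finsetSum _ fun k _ =>
          measurable_const.indicator (cell n k).measurableSet_coe]
        refine Finset.sum_congr rfl fun k _ => ?_
        rw [lintegral_indicator_const (cell n k).measurableSet_coe, Interval.volume_coe]
      _ = ∑ k ∈ Finset.range (2 ^ n), ‖φ (cell n k)‖ₑ := by
        rw [Finset.sum_range_succ, length_cell_of_le le_rfl, ENNReal.ofReal_zero, mul_zero,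
          add_zero]
        refine Finset.sum_congr rfl fun k hk => ?_
        have h2n : (0 : ℝ) < 2 ^ n := by positivity
        rw [length_cell (Finset.mem_range.1 hk), ← ofReal_norm, ← ofReal_norm,
          ← ENNReal.ofReal_mul (norm_nonneg _), norm_smul, Real.norm_of_nonneg h2n.le]
        congr 1
        field_simp
  calc
    ∫⁻ t, ‖f t‖ₑ =
        ∫⁻ t, liminf (fun n : ℕ => ‖(2 : ℝ) ^ n • φ (cell n (cellIndex n t))‖ₑ) atTop := by
      refine lintegral_congr_ae ?_
      filter_upwards [hae] with t ht
      exact ht.enorm.liminf_eq.symm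
    _ ≤ liminf (fun n : ℕ => ∫⁻ t, ‖(2 : ℝ) ^ n • φ (cell n (cellIndex n t))‖ₑ) atTop :=
      lintegral_liminf_le fun n => (hmeas n).enorm
    _ ≤ C := liminf_le_of_le (by isBoundedDefault) fun b hb => by
      obtain ⟨n, h₁, h₂⟩ := (hb.and hφ).exists
      exact h₁.trans ((hn n).trans h₂)
    _ < ⊤ := hC.lt_top

/-- The integral over `I` of an integrable function is its Henstock integral on `I`. -/
theorem IsHenstockLimit.eq_setIntegral [CompleteSpace E] (hf : Integrable f) {I : Interval} {A : E}
    (h : IsHenstockLimit ((I : Set unitInterval).indicator f) A) :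
    A = ∫ s in (I : Set unitInterval), f s := by
  rw [← integral_indicator I.measurableSet_coe]
  exact h.unique (isMcShaneLimit_integral (hf.indicator I.measurableSet_coe)).isHenstockLimit

theorem sum_enorm_setIntegral_le (f : unitInterval → E) (P : IntervalPartition) :
    ∑ i, ‖∫ s in (P.I i : Set unitInterval), f s‖ₑ ≤ ∫⁻ s, ‖f s‖ₑ := by
  rw [← P.sum_setLIntegral]
  exact Finset.sum_le_sum fun i _ => enorm_integral_le_lintegral_enorm _

/-- A variational McShane primitive has bounded sums over fine dyadic partitions. -/
theorem exists_sum_cells_le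
    (h : ∀ ε : ℝ, 0 < ε → ∃ δ, IsGauge δ ∧ ∀ π : TaggedPartition, π.IsFine δ →
      ∑ i, ‖φ (π.I i) - (π.I i).length • f (π.tag i)‖ < ε) :
    ∃ C : ENNReal, C ≠ ⊤ ∧
      ∀ᶠ n : ℕ in atTop, ∑ k ∈ Finset.range (2 ^ n), ‖φ (cell n k)‖ₑ ≤ C := by
  obtain ⟨δ, hδ, hsum⟩ := h 1 one_pos
  -- McShane tags may lie outside their intervals, so by compactness a finite set `T` of tags serves
  -- every sufficiently short cell, and `f` is bounded on `T`.
  obtain ⟨T, hT⟩ := CompactSpace.elim_nhds_subcover (fun t : unitInterval => Metric.ball t (δ t))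
    fun t => Metric.ball_mem_nhds t (hδ t)
  obtain ⟨r, hr, hball⟩ := lebesgue_number_lemma_of_metric (ι := T)
    (c := fun t => Metric.ball t.1 (δ t)) isCompact_univ (fun _ => Metric.isOpen_ball) (by
      rw [Set.iUnion_subtype]; exact hT.ge)
  obtain ⟨M, hM⟩ : ∃ M : ℝ, ∀ t ∈ T, ‖f t‖ ≤ M := by
    obtain ⟨M, hM⟩ := (T.image fun t => ‖f t‖).exists_le
    exact ⟨M, fun t ht => hM _ (Finset.mem_image_of_mem _ ht)⟩
  -- The `1` bounds the variational sum; `M` is the sum of `2 ^ n` terms, each at most `M / 2 ^ n`.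
  refine ⟨ENNReal.ofReal (1 + M), ENNReal.ofReal_ne_top, ?_⟩
  filter_upwards [tendsto_inv_two_pow.eventually_lt_const hr] with n hn
  choose τ hτ using fun k : ℕ => hball (dyadic n k) trivial
  let p : Interval → unitInterval → Prop := fun I t =>
    ∀ s ∈ I, (s : ℝ) ∈ Set.Icc ((t : ℝ) - δ t) ((t : ℝ) + δ t)
  have hp (k : ℕ) (hk : k < 2 ^ n) : p (cell n k) (τ k) := by
    intro s hs
    have h₁ : (dyadic n k : ℝ) ≤ s := hs.1
    have h₂ : (s : ℝ) ≤ dyadic n (k + 1) := hs.2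
    have hl : (dyadic n (k + 1) : ℝ) - dyadic n k = _ := length_cell hk
    have hs' : s ∈ Metric.ball (dyadic n k) r := by
      rw [Metric.mem_ball, Subtype.dist_eq, Real.dist_eq, abs_lt]
      constructor <;> linarith
    have := hτ k hs'
    rw [Metric.mem_ball, Subtype.dist_eq, Real.dist_eq, abs_lt] at this
    constructor <;> linarith [this.1, this.2]
  obtain ⟨π, hπ, hle⟩ := (hasDivision_cells (w := fun I t => ‖φ I - I.length • f t‖)
    (fun k => (τ k : unitInterval)) hp).exists_taggedPartition
  have hlt := hle.trans_lt (hsum π hπ)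
  have hb : ∑ k ∈ Finset.range (2 ^ n), ‖φ (cell n k)‖ ≤ 1 + M := by
    calc
      _ ≤ ∑ k ∈ Finset.range (2 ^ n), (‖φ (cell n k) - (cell n k).length • f (τ k)‖ +
          (2 ^ n)⁻¹ * M) := by
        refine Finset.sum_le_sum fun k hk => ?_
        have h₁ := norm_le_norm_sub_add (φ (cell n k)) ((cell n k).length • f (τ k))
        have h₂ : ‖(cell n k).length • f (τ k)‖ ≤ (2 ^ n)⁻¹ * M := by
          rw [norm_smul, Real.norm_of_nonneg (Interval.length_nonneg _),
            length_cell (Finset.mem_range.1 hk)]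
          exact mul_le_mul_of_nonneg_left (hM _ (τ k).2) (by positivity)
        linarith
      _ = ∑ k ∈ Finset.range (2 ^ n), ‖φ (cell n k) - (cell n k).length • f (τ k)‖ + M := by
        rw [Finset.sum_add_distrib, Finset.sum_const, Finset.card_range, nsmul_eq_mul]
        push_cast
        rw [mul_inv_cancel_left₀ (by positivity)]
      _ ≤ 1 + M := by linarith
  simp_rw [← ofReal_norm]
  rw [← ENNReal.ofReal_sum_of_nonneg fun _ _ => norm_nonneg _]
  exact ENNReal.ofReal_le_ofReal hb

end Vector

/-! ### Translation between multifunctions and their support functions -/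

section Multifunction

variable {X : Type*} [NormedAddCommGroup X] [NormedSpace ℝ X]

theorem hausdorffDist_riemannSum (A : CB X) (Γ : unitInterval → CB X) (π : TaggedPartition) :
    Metric.hausdorffDist (A : Set X) (riemannSum Γ π) =
      ‖supportFun (A : Set X) - ∑ i, (π.I i).length • supportFun (Γ (π.tag i) : Set X)‖ := by
  obtain ⟨h₁, h₂⟩ := isConvexBody_sum Finset.univ
    fun i => (Γ (π.tag i)).isConvexBody.smul (π.I i).length
  rw [riemannSum, hausdorffDist_eq_norm_supportFun_sub A.isConvexBody h₁, h₂]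
  congr 2
  exact Finset.sum_congr rfl fun i _ =>
    supportFun_smul (Γ _).isConvexBody (π.I i).length_nonneg

theorem hasMcShaneIntegral_iff {Γ : unitInterval → CB X} {A : CB X} :
    HasMcShaneIntegral Γ A ↔
      IsMcShaneLimit (fun t => supportFun (Γ t : Set X)) (supportFun (A : Set X)) := by
  simp only [HasMcShaneIntegral, IsMcShaneLimit, hausdorffDist_riemannSum]

theorem hasHenstockIntegral_iff {Γ : unitInterval → CB X} {A : CB X} :
    HasHenstockIntegral Γ A ↔
      IsHenstockLimit (fun t => supportFun (Γ t : Set X)) (supportFun (A : Set X)) := by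
  simp only [HasHenstockIntegral, IsHenstockLimit, hausdorffDist_riemannSum]

theorem supportFun_restrict (Γ : unitInterval → CB X) (I : Interval) :
    (fun t => supportFun (restrict Γ I t : Set X)) =
      (I : Set unitInterval).indicator fun t => supportFun (Γ t : Set X) := by
  classical
  ext1 t
  by_cases h : t ∈ I
  · have h' : t ∈ (I : Set unitInterval) := h
    simp only [restrict, if_pos h, Set.indicator_of_mem h']
  · have h' : t ∉ (I : Set unitInterval) := h
    simp only [restrict, if_neg h, Set.indicator_of_notMem h']
    exact supportFun_zero

theorem variationalSum_eq (Γ : unitInterval → CB X) (Φ : Interval → CB X) (π : TaggedPartition) :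
    variationalSum Γ Φ π = ∑ i, ‖supportFun (Φ (π.I i) : Set X) -
      (π.I i).length • supportFun (Γ (π.tag i) : Set X)‖ :=
  Finset.sum_congr rfl fun i _ => by
    rw [hausdorffDist_eq_norm_supportFun_sub (Φ _).isConvexBody ((Γ _).isConvexBody.smul _),
      supportFun_smul (Γ _).isConvexBody (π.I i).length_nonneg]

theorem hausdorffEDist_singleton_zero (A : CB X) :
    Metric.hausdorffEDist (A : Set X) {0} = ‖supportFun (A : Set X)‖ₑ := by
  have h0 := (0 : CB X).isConvexBody
  have h := hausdorffDist_eq_norm_supportFun_sub A.isConvexBody isConvexBody_zero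
  rw [supportFun_zero, sub_zero, ← Set.singleton_zero] at h
  rw [← ofReal_norm, ← h, Metric.hausdorffDist, ENNReal.ofReal_toReal]
  exact Metric.hausdorffEDist_ne_top_of_nonempty_of_bounded A.nonempty h0.nonempty
    A.isBounded h0.isBounded

theorem IsIndefiniteMcShaneIntegral.isIndefiniteHenstockIntegral {Γ : unitInterval → CB X}
    {Φ : Interval → CB X} (h : IsIndefiniteMcShaneIntegral Γ Φ) :
    IsIndefiniteHenstockIntegral Γ Φ := fun I =>
  hasHenstockIntegral_iff.2 (hasMcShaneIntegral_iff.1 (h I)).isHenstockLimit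

theorem IsIndefiniteHenstockIntegral.supportFun_eq {Γ : unitInterval → CB X}
    {Φ : Interval → CB X} (h : IsIndefiniteHenstockIntegral Γ Φ)
    (hΓ : Integrable fun t => supportFun (Γ t : Set X)) (I : Interval) :
    supportFun (Φ I : Set X) = ∫ t in (I : Set unitInterval), supportFun (Γ t : Set X) :=
  IsHenstockLimit.eq_setIntegral hΓ
    (supportFun_restrict Γ I ▸ hasHenstockIntegral_iff.1 (h I))

theorem sum_cells_le_intervalVariation (Φ : Interval → CB X) (n : ℕ) :
    ∑ k ∈ Finset.range (2 ^ n), ‖supportFun (Φ (cell n k) : Set X)‖ₑ ≤ intervalVariation Φ := by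
  obtain ⟨π, -, h⟩ := (hasDivision_cells (n := n) (p := fun _ _ => True)
    (w := fun I _ => ‖supportFun (Φ I : Set X)‖) (fun _ => 0)
    fun _ _ => trivial).exists_taggedPartition
  refine le_trans ?_ (le_iSup _ π.toIntervalPartition)
  simp_rw [hausdorffEDist_singleton_zero, ← ofReal_norm]
  rw [← ENNReal.ofReal_sum_of_nonneg fun _ _ => norm_nonneg _,
    ← ENNReal.ofReal_sum_of_nonneg fun _ _ => norm_nonneg _]
  exact ENNReal.ofReal_le_ofReal h

end Multifunction

end MultiInt

/-! ### The equivalence -/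

theorem mainTheorem2 {X : Type*} [NormedAddCommGroup X] [NormedSpace ℝ X] [CompleteSpace X]
    (Γ : unitInterval → MultiInt.CB X) :
    MultiInt.VariationallyMcShaneIntegrable Γ ↔
      MultiInt.VariationallyHenstockIntegrable Γ ∧
        ∃ Φ : MultiInt.Interval → MultiInt.CB X,
          MultiInt.IsIndefiniteHenstockIntegral Γ Φ ∧ MultiInt.intervalVariation Φ < ⊤ := by
  open MultiInt in
  constructor
  · rintro ⟨Φ, hΦ, hv⟩
    have hvH : ∀ ε : ℝ, 0 < ε → ∃ δ, IsGauge δ ∧ ∀ π : TaggedPartition, π.IsPerron →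
        π.IsFine δ → variationalSum Γ Φ π < ε := fun ε hε =>
      let ⟨δ, hδ, h⟩ := hv ε hε
      ⟨δ, hδ, fun π _ hπ => h π hπ⟩
    have hΦH := hΦ.isIndefiniteHenstockIntegral
    refine ⟨⟨Φ, hΦH, hvH⟩, Φ, hΦH, ?_⟩
    simp only [variationalSum_eq] at hv hvH
    obtain ⟨C, hC, hle⟩ := exists_sum_cells_le
      (f := fun t => supportFun (Γ t : Set X)) (φ := fun I => supportFun (Φ I : Set X)) hv
    have hf : MeasureTheory.Integrable fun t => supportFun (Γ t : Set X) :=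
      integrable_of_sum_cells_le (φ := fun I => supportFun (Φ I : Set X)) hvH hC hle
    refine lt_of_le_of_lt (iSup_le fun P => ?_) hf.2
    simp_rw [hausdorffEDist_singleton_zero, hΦH.supportFun_eq hf]
    exact sum_enorm_setIntegral_le _ P
  · rintro ⟨⟨Φ, hΦ, hv⟩, Φ', hΦ', hvar⟩
    simp only [variationalSum_eq] at hv
    -- The variation bound is given for `Φ'`, the variational estimate for `Φ`; uniqueness of the
    -- integral identifies them.
    have heq (I) : supportFun (Φ I : Set X) = supportFun (Φ' I : Set X) :=
      (hasHenstockIntegral_iff.1 (hΦ I)).unique (hasHenstockIntegral_iff.1 (hΦ' I))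
    have hf : MeasureTheory.Integrable fun t => supportFun (Γ t : Set X) :=
      integrable_of_sum_cells_le (φ := fun I => supportFun (Φ I : Set X)) hv hvar.ne
        (Filter.Eventually.of_forall fun n => by
          simp_rw [heq]
          exact sum_cells_le_intervalVariation Φ' n)
    refine ⟨Φ, fun I => ?_, fun ε hε => ?_⟩
    · rw [hasMcShaneIntegral_iff, supportFun_restrict, hΦ.supportFun_eq hf,
        ← MeasureTheory.integral_indicator I.measurableSet_coe]
      exact isMcShaneLimit_integral (hf.indicator I.measurableSet_coe)
    · simp_rw [variationalSum_eq, hΦ.supportFun_eq hf]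
      exact exists_gauge_sum_norm_lt hf hε
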